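/- Let $\Omega\subset\mathbb{R}^d$ be open, let $\sigma$ be a symmetric bilinear form on $H^1(\Omega)$ which is continuous and coercive, i.e. $|\sigma(u,v)|\le C\|u\|_{H^1}\|v\|_{H^1}$ and $\sigma(u,u)\ge c\|u\|_{H^1}^2$ for all $u,v\in H^1(\Omega)$ with constants $C,c>0$, and let $A,A^*:H^1(\Omega)\to H^{-1}(\Omega)=H^1_0(\Omega)'$ be given by $\langle Au,v\rangle=\sigma(u,v)$ and $\langle A^*u,v\rangle=\sigma(v,u)$ for $v\in H^1_0(\Omega)$. Let $f,z\in L^2(\Omega)$, $\nu>0$, $\delta>0$, $\mathcal U=H^2(\Omega)\cap H^1_0(\Omega)$, and let $\beta_\delta\in C^1(\mathbb{R})$ be $$\beta_\delta(r)=\frac1\delta\begin{cases}0,& r\ge 0,\\ -r^2,& -\tfrac12\le r\le 0,\\ r+\tfrac14,& r\le-\tfrac12.\end{cases}$$ Define the iteration map $F$ on $\mathcal U\times\mathcal U$ as follows. Given $(\varphi,\psi)\in\mathcal U\times\mathcal U$, let 1. $y=F_1(\varphi,\psi)\in\mathcal U$ be a solution of $Ay+\beta_\delta(y-\varphi)-\beta_\delta(\psi-y)=f$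 in $\Omega$; 2. $p=F_2(y,\varphi,\psi)\in\mathcal U$ be a solution of $Ap+\beta_\delta'(y-\varphi)p+\beta_\delta'(\psi-y)p=y-z$ in $\Omega$; 3. $\lambda=\nu\Delta\varphi+\beta_\delta'(y-\varphi)p\in L^2(\Omega)$; 4. $\psi_{+}=F_3(y,p)\in\mathcal U$ be a solution of $\nu\Delta\psi_{+}+\beta_\delta'(\psi_{+}-y)p=-\lambda$ in $\Omega$; 5. $\varphi_{+}=F_4(y,p)\in\mathcal U$ be a solution of $-\lambda+\nu\Delta\varphi_{+}+\beta_\delta'(y-\varphi_{+})p=0$ in $\Omega$. Then $F(\varphi,\psi)$ is $(\varphi_{+},\psi_{+})$. Where some of these problems are not uniquely solvable, $F(\varphi,\psi)$ is understood as the set of all pairs $(\varphi_+,\psi_+)$ obtained in this way, and a fixed point is a pair with $(\varphi,\psi)\in F(\varphi,\psi)$; in particular every fixed point of a single-valued selection of $F$ is one. **Theorem.** Let $(\bar\varphi^\delta,\bar\psi^\delta)\in\mathcal U\times\mathcal U$ be a fixed point of $F$, that is, a solution of $(\bar\varphi^\delta,\bar\psi^\delta)-F(\bar\varphi^\delta,\bar\psi^\delta)=0$.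 Then $\bar y^\delta=F_1(\bar\varphi^\delta,\bar\psi^\delta)\in\mathcal U$ and $\bar p^\delta=F_2(\bar y^\delta,\bar\varphi^\delta,\bar\psi^\delta)\in\mathcal U$ exist and are uniquely determined, and $(\bar y^\delta,\bar p^\delta,\bar\varphi^\delta,\bar\psi^\delta)$ satisfies the penalized optimality system $(S^\delta)$: $$\begin{cases}A\bar y^\delta+\beta_\delta(\bar y^\delta-\bar\varphi^\delta)-\beta_\delta(\bar\psi^\delta-\bar y^\delta)=f&\text{in }\Omega,\\ A^*\bar p^\delta+\mu_1^\delta+\mu_2^\delta=\bar y^\delta-z&\text{in }\Omega,\\ \nu\Delta\bar\varphi^\delta+\nu\Delta\bar\psi^\delta+\mu_1^\delta+\mu_2^\delta=0&\text{in }\Omega,\\ \bar y^\delta=\bar p^\delta=\bar\varphi^\delta=\bar\psi^\delta=0&\text{on }\partial\Omega,\end{cases}$$ where $\mu_1^\delta=\beta_\delta'(\bar y^\delta-\bar\varphi^\delta)\bar p^\delta$ and $\mu_2^\delta=\beta_\delta'(\bar\psi^\delta-\bar y^\delta)\bar p^\delta$ belong to $L^2(\Omega)$. The first two equations hold in $H^{-1}(\Omega)$,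 the third in $L^2(\Omega)$, and the boundary conditions mean membership in $H^1_0(\Omega)$. -/

import Mathlib

open MeasureTheory Set Filter Topology
open scoped ContDiff InnerProductSpace

noncomputable section

namespace ObstacleControl

/-! ### The penalty function -/

/-- The penalty function `β_δ` on the real line. -/
def beta (δ r : ℝ) : ℝ :=
  (1 / δ) * (if 0 ≤ r then 0 else if -(1 / 2) ≤ r then -r ^ 2 else r + 1 / 4)

/-- The derivative `β_δ'` of the penalty function (see `hasDerivAt_beta`). -/
def betaDeriv (δ r : ℝ) : ℝ :=
  (1 / δ) * (if 0 ≤ r then 0 else if -(1 / 2) ≤ r then -2 * r else 1)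

theorem beta_eq (δ r : ℝ) :
    beta δ r = (1 / δ) * (-(min (max (-r) 0) (1 / 2)) ^ 2 - max (-r - 1 / 2) 0) := by
  unfold beta
  congr 1
  split_ifs with h1 h2
  · rw [max_eq_right (by linarith), max_eq_right (by linarith), min_eq_left (by norm_num)]; simp
  · rw [max_eq_left (by linarith), max_eq_right (by linarith), min_eq_left (by linarith)]; ring
  · rw [max_eq_left (by linarith), max_eq_left (by linarith), min_eq_right (by linarith)]; ring

theorem betaDeriv_eq (δ r : ℝ) : betaDeriv δ r = (1 / δ) * (2 * min (max (-r) 0) (1 / 2)) := by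
  unfold betaDeriv
  congr 1
  split_ifs with h1 h2
  · rw [max_eq_right (by linarith), min_eq_left (by norm_num)]; simp
  · rw [max_eq_left (by linarith), min_eq_left (by linarith)]; ring
  · rw [max_eq_left (by linarith), min_eq_right (by linarith)]; ring

theorem continuous_beta (δ : ℝ) : Continuous (beta δ) := by
  rw [funext (beta_eq δ)]; fun_prop

theorem continuous_betaDeriv (δ : ℝ) : Continuous (betaDeriv δ) := by
  rw [funext (betaDeriv_eq δ)]; fun_prop

theorem abs_beta_le (δ r : ℝ) : |beta δ r| ≤ |1 / δ| * |r| := by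
  unfold beta
  rw [abs_mul]
  refine mul_le_mul_of_nonneg_left ?_ (abs_nonneg _)
  split_ifs with h1 h2
  · simp
  · rw [abs_of_neg (not_le.mp h1), abs_of_nonpos (by nlinarith)]; nlinarith
  · rw [abs_of_neg (not_le.mp h1), abs_of_nonpos (by linarith)]; linarith

theorem abs_betaDeriv_le (δ r : ℝ) : |betaDeriv δ r| ≤ |1 / δ| := by
  unfold betaDeriv
  rw [abs_mul]
  refine mul_le_of_le_one_right (abs_nonneg _) ?_
  split_ifs with h1 h2
  · simp
  · rw [abs_of_nonneg (by linarith)]; linarith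
  · simp

theorem hasDerivAt_beta (δ r : ℝ) : HasDerivAt (beta δ) (betaDeriv δ r) r := by
  -- `r ↦ -(max (-r) 0)^2 + (max (-r - 1/2) 0)^2` is the bracket in `beta`.
  have key : ∀ s : ℝ, HasDerivAt (fun t : ℝ => (max t 0) ^ 2) (2 * max s 0) s := by
    intro s
    rcases lt_trichotomy s 0 with hs | hs | hs
    · have : (fun t : ℝ => (max t 0) ^ 2) =ᶠ[𝓝 s] fun _ => 0 := by
        filter_upwards [gt_mem_nhds hs] with t ht
        rw [max_eq_right (le_of_lt ht)]; simp
      rw [max_eq_right hs.le]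
      simpa using (hasDerivAt_const s (0 : ℝ)).congr_of_eventuallyEq this
    · subst hs
      have h : (fun t : ℝ => (max t 0) ^ 2) =O[𝓝 0] fun t : ℝ => (t - 0) ^ 2 := by
        refine Asymptotics.IsBigO.of_bound 1 (Eventually.of_forall fun t => ?_)
        rw [Real.norm_of_nonneg (by positivity), Real.norm_of_nonneg (by positivity), one_mul,
          sub_zero]
        rcases le_total t 0 with ht | ht
        · rw [max_eq_right ht]; nlinarith
        · rw [max_eq_left ht]
      rw [max_self, mul_zero, hasDerivAt_iff_isLittleO]
      have h2 : (fun t : ℝ => (t - 0) ^ 2) =o[𝓝 0] fun t : ℝ => t - 0 := by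
        simpa using (Asymptotics.isLittleO_pow_id (𝕜 := ℝ) (n := 2) (by norm_num))
      simpa using (h.trans_isLittleO h2)
    · have : (fun t : ℝ => (max t 0) ^ 2) =ᶠ[𝓝 s] fun t => t ^ 2 := by
        filter_upwards [lt_mem_nhds hs] with t ht
        rw [max_eq_left (le_of_lt ht)]
      rw [max_eq_left hs.le]
      simpa using (hasDerivAt_pow 2 s).congr_of_eventuallyEq this
  have e1 : beta δ = fun r => (1 / δ) * ((max (-r - 1 / 2) 0) ^ 2 - (max (-r) 0) ^ 2) := by
    funext r
    unfold beta
    congr 1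
    split_ifs with h1 h2
    · rw [max_eq_right (by linarith), max_eq_right (by linarith)]; simp
    · rw [max_eq_right (by linarith), max_eq_left (by linarith)]; ring
    · rw [max_eq_left (by linarith), max_eq_left (by linarith)]; ring
  have e2 : betaDeriv δ r =
      (1 / δ) * (2 * max (-r - 1 / 2) 0 * (-1) - 2 * max (-r) 0 * (-1)) := by
    unfold betaDeriv
    congr 1
    split_ifs with h1 h2
    · rw [max_eq_right (by linarith), max_eq_right (by linarith)]; simp
    · rw [max_eq_right (by linarith), max_eq_left (by linarith)]; ring
    · rw [max_eq_left (by linarith), max_eq_left (by linarith)]; ring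
  rw [e1, e2]
  have d1 : HasDerivAt (fun r : ℝ => -r - 1 / 2) (-1) r :=
    (hasDerivAt_id r).neg.sub_const _
  have d2 : HasDerivAt (fun r : ℝ => -r) (-1) r := (hasDerivAt_id r).neg
  exact (((key _).comp r d1).sub ((key _).comp r d2)).const_mul _

/-! ### Sobolev spaces on an open set `Ω` of `ℝ^d` -/

variable {d : ℕ}

/-- `L²(Ω)`. -/
abbrev L2 (Ω : Set (EuclideanSpace ℝ (Fin d))) : Type :=
  Lp ℝ 2 (volume.restrict Ω)

/-- The `i`-th classical partial derivative. -/
def partialDeriv (i : Fin d) (η : EuclideanSpace ℝ (Fin d) → ℝ) (x : EuclideanSpace ℝ (Fin d)) :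
    ℝ :=
  fderiv ℝ η x (EuclideanSpace.single i 1)

/-- `η ∈ C_c^∞(Ω)`. -/
structure IsTestFunction (Ω : Set (EuclideanSpace ℝ (Fin d)))
    (η : EuclideanSpace ℝ (Fin d) → ℝ) : Prop where
  smooth : ContDiff ℝ ∞ η
  hasCompactSupport : HasCompactSupport η
  tsupport_subset : tsupport η ⊆ Ω

/-- `g` is the weak `i`-th partial derivative of `u` in `Ω`. -/
def IsWeakDeriv (Ω : Set (EuclideanSpace ℝ (Fin d))) (i : Fin d) (u g : L2 Ω) : Prop :=
  ∀ η : EuclideanSpace ℝ (Fin d) → ℝ, IsTestFunction Ω η →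
    ∫ x in Ω, u x * partialDeriv i η x = -∫ x in Ω, g x * η x

theorem IsTestFunction.continuous_partialDeriv {Ω : Set (EuclideanSpace ℝ (Fin d))}
    {η : EuclideanSpace ℝ (Fin d) → ℝ} (hη : IsTestFunction Ω η) (i : Fin d) :
    Continuous (partialDeriv i η) :=
  (hη.smooth.continuous_fderiv (by simp)).clm_apply continuous_const

theorem IsTestFunction.memLp {Ω : Set (EuclideanSpace ℝ (Fin d))}
    {η : EuclideanSpace ℝ (Fin d) → ℝ} (hη : IsTestFunction Ω η) :
    MemLp η 2 (volume.restrict Ω) :=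
  (hη.smooth.continuous.memLp_of_hasCompactSupport hη.hasCompactSupport).restrict Ω

theorem IsTestFunction.memLp_partialDeriv {Ω : Set (EuclideanSpace ℝ (Fin d))}
    {η : EuclideanSpace ℝ (Fin d) → ℝ} (hη : IsTestFunction Ω η) (i : Fin d) :
    MemLp (partialDeriv i η) 2 (volume.restrict Ω) := by
  refine ((hη.continuous_partialDeriv i).memLp_of_hasCompactSupport ?_).restrict Ω
  exact hη.hasCompactSupport.fderiv_apply ℝ _

theorem IsWeakDeriv.zero {Ω : Set (EuclideanSpace ℝ (Fin d))} (i : Fin d) :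
    IsWeakDeriv Ω i 0 0 := by
  intro η _
  have h : ∀ k : EuclideanSpace ℝ (Fin d) → ℝ, ∫ x in Ω, (0 : L2 Ω) x * k x = 0 := by
    intro k
    refine integral_eq_zero_of_ae ?_
    filter_upwards [Lp.coeFn_zero ℝ 2 (volume.restrict Ω)] with x hx
    rw [hx]; simp
  rw [h, h, neg_zero]

theorem IsWeakDeriv.add {Ω : Set (EuclideanSpace ℝ (Fin d))} {i : Fin d} {u v g k : L2 Ω}
    (hu : IsWeakDeriv Ω i u g) (hv : IsWeakDeriv Ω i v k) : IsWeakDeriv Ω i (u + v) (g + k) := by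
  intro η hη
  have h : ∀ (a b : L2 Ω) (m : EuclideanSpace ℝ (Fin d) → ℝ), MemLp m 2 (volume.restrict Ω) →
      ∫ x in Ω, (a + b) x * m x = (∫ x in Ω, a x * m x) + ∫ x in Ω, b x * m x := by
    intro a b m hm
    have ha : Integrable (fun x => a x * m x) (volume.restrict Ω) :=
      (Lp.memLp a).integrable_mul hm
    have hb : Integrable (fun x => b x * m x) (volume.restrict Ω) :=
      (Lp.memLp b).integrable_mul hm
    rw [← integral_add ha hb]
    refine integral_congr_ae ?_
    filter_upwards [Lp.coeFn_add a b] with x hx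
    rw [hx, Pi.add_apply, add_mul]
  rw [h _ _ _ (hη.memLp_partialDeriv i), h _ _ _ hη.memLp, hu η hη, hv η hη]
  ring

theorem IsWeakDeriv.smul {Ω : Set (EuclideanSpace ℝ (Fin d))} {i : Fin d} {u g : L2 Ω}
    (c : ℝ) (hu : IsWeakDeriv Ω i u g) : IsWeakDeriv Ω i (c • u) (c • g) := by
  intro η hη
  have h : ∀ (a : L2 Ω) (m : EuclideanSpace ℝ (Fin d) → ℝ),
      ∫ x in Ω, (c • a) x * m x = c * ∫ x in Ω, a x * m x := by
    intro a m
    rw [← integral_const_mul]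
    refine integral_congr_ae ?_
    filter_upwards [Lp.coeFn_smul c a] with x hx
    rw [hx, Pi.smul_apply, smul_eq_mul, mul_assoc]
  rw [h, h, hu η hη]
  ring

/-- `H¹(Ω)`, realised as the space of pairs `(u, ∇u)` where `u ∈ L²(Ω)` has the weak gradient
`∇u ∈ L²(Ω)^d`. The norm inherited from the Hilbert sum is the usual one,
`‖u‖² = ‖u‖²_{L²} + ∑ i, ‖∂ᵢ u‖²_{L²}`. -/
def H1 (Ω : Set (EuclideanSpace ℝ (Fin d))) :
    Submodule ℝ (WithLp 2 (L2 Ω × PiLp 2 (fun _ : Fin d => L2 Ω))) where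
  carrier := {w | ∀ i, IsWeakDeriv Ω i w.fst (w.snd i)}
  zero_mem' := fun i => IsWeakDeriv.zero i
  add_mem' := fun ha hb i => (ha i).add (hb i)
  smul_mem' := fun c _ ha i => (ha i).smul c

variable {Ω : Set (EuclideanSpace ℝ (Fin d))}

/-- The embedding `H¹(Ω) → L²(Ω)`. -/
def H1.toL2 : H1 Ω →L[ℝ] L2 Ω :=
  ((ContinuousLinearMap.fst ℝ _ _).comp
    (WithLp.prodContinuousLinearEquiv 2 ℝ (L2 Ω)
      (PiLp 2 (fun _ : Fin d => L2 Ω))).toContinuousLinearMap).comp (H1 Ω).subtypeL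

/-- The weak partial derivative `∂ᵢ u` of `u ∈ H¹(Ω)`. -/
def H1.grad (u : H1 Ω) (i : Fin d) : L2 Ω := u.1.snd i

/-- `H¹₀(Ω)`, the closure of `C_c^∞(Ω)` in `H¹(Ω)`. -/
def H10 (Ω : Set (EuclideanSpace ℝ (Fin d))) : Submodule ℝ (H1 Ω) :=
  (Submodule.span ℝ {u : H1 Ω | ∃ η, IsTestFunction Ω η ∧
    (H1.toL2 u : EuclideanSpace ℝ (Fin d) → ℝ) =ᵐ[volume.restrict Ω] η ∧
    ∀ i, (H1.grad u i : EuclideanSpace ℝ (Fin d) → ℝ)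
      =ᵐ[volume.restrict Ω] partialDeriv i η}).topologicalClosure

/-- `H²(Ω)` as a subspace of `H¹(Ω)`: all first derivatives have weak derivatives in `L²(Ω)`. -/
def H2 (Ω : Set (EuclideanSpace ℝ (Fin d))) : Submodule ℝ (H1 Ω) where
  carrier := {u | ∀ i j, ∃ g : L2 Ω, IsWeakDeriv Ω j (H1.grad u i) g}
  zero_mem' := fun _ j => ⟨0, IsWeakDeriv.zero j⟩
  add_mem' := fun ha hb i j => by
    obtain ⟨g, hg⟩ := ha i j
    obtain ⟨k, hk⟩ := hb i j
    exact ⟨g + k, hg.add hk⟩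
  smul_mem' := fun c _ ha i j => by
    obtain ⟨g, hg⟩ := ha i j
    exact ⟨c • g, hg.smul c⟩

/-- `𝒰 = H²(Ω) ∩ H¹₀(Ω)`. -/
abbrev U (Ω : Set (EuclideanSpace ℝ (Fin d))) : Submodule ℝ (H1 Ω) := H2 Ω ⊓ H10 Ω

/-- The function in `L²(Ω)` underlying an element of `𝒰`. -/
abbrev fn (u : U Ω) : L2 Ω := H1.toL2 u.1

open Classical in
/-- The weak `i`-th partial derivative of `u ∈ L²(Ω)` when it exists in `L²(Ω)`, and `0`
otherwise. -/
def weakDeriv (i : Fin d) (u : L2 Ω) : L2 Ω :=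
  if h : ∃ g, IsWeakDeriv Ω i u g then h.choose else 0

/-- The Laplacian `Δu = ∑ᵢ ∂ᵢ ∂ᵢ u ∈ L²(Ω)` of `u ∈ 𝒰`. -/
def laplacian (u : U Ω) : L2 Ω := ∑ i, weakDeriv i (H1.grad u.1 i)

/-! ### The operators in the equations -/

/-- `H⁻¹(Ω)`, the dual of `H¹₀(Ω)`. -/
abbrev Hminus1 (Ω : Set (EuclideanSpace ℝ (Fin d))) : Type := StrongDual ℝ (H10 Ω)

/-- The embedding `L²(Ω) → H⁻¹(Ω)`, `g ↦ (v ↦ (g, v)_{L²})`. -/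
def toHminus1 (g : L2 Ω) : Hminus1 Ω :=
  (innerSL ℝ g).comp (H1.toL2.comp (H10 Ω).subtypeL)

/-- The operator `A : H¹(Ω) → H⁻¹(Ω)` of the bilinear form `σ`: `⟨A u, v⟩ = σ(u, v)`. -/
def opA (σ : H1 Ω →L[ℝ] H1 Ω →L[ℝ] ℝ) (u : H1 Ω) : Hminus1 Ω :=
  (σ u).comp (H10 Ω).subtypeL

/-- The adjoint operator `A*`, given by the adjoint form: `⟨A* u, v⟩ = σ*(u, v) = σ(v, u)`. -/
def opAstar (σ : H1 Ω →L[ℝ] H1 Ω →L[ℝ] ℝ) (u : H1 Ω) : Hminus1 Ω :=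
  opA σ.flip u

theorem memLp_beta (δ : ℝ) (w : L2 Ω) :
    MemLp (fun x => beta δ (w x)) 2 (volume.restrict Ω) :=
  (Lp.memLp w).of_le_mul (c := |1 / δ|)
    ((continuous_beta δ).comp_aestronglyMeasurable (Lp.aestronglyMeasurable w))
    (Eventually.of_forall fun x => abs_beta_le δ (w x))

theorem memLp_betaDeriv_mul (δ : ℝ) (w p : L2 Ω) :
    MemLp (fun x => betaDeriv δ (w x) * p x) 2 (volume.restrict Ω) :=
  (Lp.memLp p).of_le_mul (c := |1 / δ|)
    (((continuous_betaDeriv δ).comp_aestronglyMeasurable (Lp.aestronglyMeasurable w)).mul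
      (Lp.aestronglyMeasurable p))
    (Eventually.of_forall fun x => by
      rw [norm_mul]
      exact mul_le_mul_of_nonneg_right (abs_betaDeriv_le δ (w x)) (norm_nonneg _))

/-- `β_δ(w) ∈ L²(Ω)` for `w ∈ L²(Ω)`. -/
def betaL2 (δ : ℝ) (w : L2 Ω) : L2 Ω := (memLp_beta δ w).toLp _

/-- `β_δ'(w) p ∈ L²(Ω)` for `w, p ∈ L²(Ω)`. -/
def betaDerivL2 (δ : ℝ) (w p : L2 Ω) : L2 Ω := (memLp_betaDeriv_mul δ w p).toLp _

/-! ### The iteration map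

Each step of the iteration solves a boundary value problem, and the corresponding map is its
solution operator, with values in the subsets of `𝒰`: the value is the set of all solutions in `𝒰`
(a singleton where the problem is uniquely solvable). Homogeneous boundary values are part of the
membership in `𝒰`. -/

/-- `F₁(φ, ψ)`: the solutions `y` of `A y + β_δ(y - φ) - β_δ(ψ - y) = f` in `Ω`, `y = 0` on
`∂Ω`. -/
def F1 (σ : H1 Ω →L[ℝ] H1 Ω →L[ℝ] ℝ) (f : L2 Ω) (δ : ℝ) (φ ψ : U Ω) : Set (U Ω) :=
  {y | opA σ y.1 + toHminus1 (betaL2 δ (fn y - fn φ) - betaL2 δ (fn ψ - fn y)) = toHminus1 f}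

/-- `F₂(y, φ, ψ)`: the solutions `p` of
`A p + β_δ'(y - φ) p + β_δ'(ψ - y) p = y - z` in `Ω`, `p = 0` on `∂Ω`. -/
def F2 (σ : H1 Ω →L[ℝ] H1 Ω →L[ℝ] ℝ) (z : L2 Ω) (δ : ℝ) (y φ ψ : U Ω) : Set (U Ω) :=
  {p | opA σ p.1 + toHminus1 (betaDerivL2 δ (fn y - fn φ) (fn p)) +
      toHminus1 (betaDerivL2 δ (fn ψ - fn y) (fn p)) = toHminus1 (fn y - z)}

/-- The multiplier `λ = ν Δφ + β_δ'(y - φ) p`, computed from the previous `φ`. -/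
def multiplier (ν δ : ℝ) (φ y p : U Ω) : L2 Ω :=
  ν • laplacian φ + betaDerivL2 δ (fn y - fn φ) (fn p)

/-- `F₃`: the solutions `ψ` of `ν Δψ + β_δ'(ψ - y) p = -λ` in `Ω`, `ψ = 0` on `∂Ω`. -/
def F3 (ν δ : ℝ) (lam : L2 Ω) (y p : U Ω) : Set (U Ω) :=
  {ψ | ν • laplacian ψ + betaDerivL2 δ (fn ψ - fn y) (fn p) = -lam}

/-- `F₄`: the solutions `φ` of `-λ + ν Δφ + β_δ'(y - φ) p = 0` in `Ω`, `φ = 0` on `∂Ω`. -/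
def F4 (ν δ : ℝ) (lam : L2 Ω) (y p : U Ω) : Set (U Ω) :=
  {φ | -lam + ν • laplacian φ + betaDerivL2 δ (fn y - fn φ) (fn p) = 0}

/-- The iteration map `F` on `𝒰 × 𝒰`: `F w` consists of the pairs `(φₙ, ψₙ)` which one sweep
`y = F₁(φ, ψ)`, `p = F₂(y, φ, ψ)`, `λ = ν Δφ + β_δ'(y - φ) p`, `ψₙ = F₃(y, p)`, `φₙ = F₄(y, p)`
produces from `w = (φ, ψ)`. -/
def F (σ : H1 Ω →L[ℝ] H1 Ω →L[ℝ] ℝ) (f z : L2 Ω) (ν δ : ℝ) (w : U Ω × U Ω) :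
    Set (U Ω × U Ω) :=
  {w' | ∃ y ∈ F1 σ f δ w.1 w.2, ∃ p ∈ F2 σ z δ y w.1 w.2,
    w'.1 ∈ F4 ν δ (multiplier ν δ w.1 y p) y p ∧
    w'.2 ∈ F3 ν δ (multiplier ν δ w.1 y p) y p}

/-- The penalized optimality system `(S^δ)` for `(y, p, φ, ψ)`, with `μ₁ = β_δ'(y - φ) p` and
`μ₂ = β_δ'(ψ - y) p`. The boundary conditions `y = p = φ = ψ = 0` on `∂Ω` are the memberships
in `𝒰 ⊆ H¹₀(Ω)`. -/
structure OptimalitySystem (σ : H1 Ω →L[ℝ] H1 Ω →L[ℝ] ℝ) (f z : L2 Ω) (ν δ : ℝ)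
    (y p φ ψ : U Ω) : Prop where
  state : opA σ y.1 + toHminus1 (betaL2 δ (fn y - fn φ) - betaL2 δ (fn ψ - fn y)) = toHminus1 f
  adjoint : opAstar σ p.1 + toHminus1 (betaDerivL2 δ (fn y - fn φ) (fn p)) +
      toHminus1 (betaDerivL2 δ (fn ψ - fn y) (fn p)) = toHminus1 (fn y - z)
  control : ν • laplacian φ + ν • laplacian ψ + betaDerivL2 δ (fn y - fn φ) (fn p) +
      betaDerivL2 δ (fn ψ - fn y) (fn p) = 0

end ObstacleControl

end

/-!
Existence of `y` and `p` is part of what it means for `(φ, ψ)` to be a fixed point, so the content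
is uniqueness together with the optimality system.

Uniqueness is a monotonicity argument. If `u, v ∈ 𝒰` solve `A u + g = A v + h` in `H⁻¹(Ω)`, then
testing with `u - v ∈ H¹₀(Ω)` gives `σ(u - v, u - v) + (g - h, u - v) = 0`; when the second term is
nonnegative, coercivity forces `u = v` (`eq_of_opA_add_toHminus1_eq`). In the state equation the
second term is nonnegative because `β_δ` is nondecreasing, and in the equation for `p`, which is
linear in `p`, because `β_δ' ≥ 0`.

In the optimality system, the adjoint equation is the equation for `p` since `σ` is symmetric, and
the last equation is the equation for `ψ₊ = ψ` in which `λ = ν Δφ + β_δ'(y - φ) p` is inserted.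
-/

noncomputable section

namespace ObstacleControl

theorem betaDeriv_nonneg {δ : ℝ} (hδ : 0 < δ) (r : ℝ) : 0 ≤ betaDeriv δ r := by
  rw [betaDeriv_eq]
  positivity

theorem monotone_beta {δ : ℝ} (hδ : 0 < δ) : Monotone (beta δ) :=
  monotone_of_hasDerivAt_nonneg (hasDerivAt_beta δ) (betaDeriv_nonneg hδ)

variable {d : ℕ} {Ω : Set (EuclideanSpace ℝ (Fin d))}

/-- Uniqueness for the boundary value problem `A u + G(u) = f` when `G` is monotone along the two
solutions: here `g = G(u)` and `h = G(v)`. -/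
theorem eq_of_opA_add_toHminus1_eq {σ : H1 Ω →L[ℝ] H1 Ω →L[ℝ] ℝ} (hσ : IsCoercive σ)
    {u v : U Ω} {g h : L2 Ω}
    (heq : opA σ u.1 + toHminus1 g = opA σ v.1 + toHminus1 h)
    (hmono : 0 ≤ ⟪g - h, fn u - fn v⟫_ℝ) : u = v := by
  obtain ⟨c, hc, hcoer⟩ := hσ
  have htest := congrArg (fun L : Hminus1 Ω => L ⟨u.1 - v.1, (u - v).2.2⟩) heq
  change σ u.1 (u.1 - v.1) + ⟪g, H1.toL2 (u.1 - v.1)⟫_ℝ =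
    σ v.1 (u.1 - v.1) + ⟪h, H1.toL2 (u.1 - v.1)⟫_ℝ at htest
  rw [map_sub H1.toL2] at htest
  rw [inner_sub_left] at hmono
  have hσw : σ (u.1 - v.1) (u.1 - v.1) ≤ 0 := by
    rw [map_sub σ u.1 v.1, sub_apply]
    linarith
  have hnorm : ‖u.1 - v.1‖ = 0 := by
    by_contra hne
    have hpos : 0 < ‖u.1 - v.1‖ := lt_of_le_of_ne (norm_nonneg _) (Ne.symm hne)
    exact absurd ((hcoer _).trans hσw) (not_le.mpr (by positivity))
  exact Subtype.ext (sub_eq_zero.mp (norm_eq_zero.mp hnorm))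

theorem toHminus1_add (g h : L2 Ω) : toHminus1 (g + h) = toHminus1 g + toHminus1 h := by
  ext v
  exact inner_add_left (𝕜 := ℝ) g h (H1.toL2 v.1)

theorem inner_L2_nonneg_of_ae {g h : L2 Ω} (hgh : ∀ᵐ x ∂volume.restrict Ω, 0 ≤ g x * h x) :
    0 ≤ ⟪g, h⟫_ℝ := by
  rw [L2.inner_def]
  refine integral_nonneg_of_ae ?_
  filter_upwards [hgh] with x hx
  simpa [mul_comm] using hx

theorem inner_betaL2_sub_nonneg {δ : ℝ} (hδ : 0 < δ) (w₁ w₂ : L2 Ω) :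
    0 ≤ ⟪betaL2 δ w₁ - betaL2 δ w₂, w₁ - w₂⟫_ℝ := by
  refine inner_L2_nonneg_of_ae ?_
  filter_upwards [Lp.coeFn_sub (betaL2 δ w₁) (betaL2 δ w₂), Lp.coeFn_sub w₁ w₂,
    (memLp_beta δ w₁).coeFn_toLp, (memLp_beta δ w₂).coeFn_toLp] with x h₁ h₂ h₃ h₄
  rw [h₁, h₂, Pi.sub_apply, Pi.sub_apply, betaL2, betaL2, h₃, h₄]
  rcases le_total (w₁ x) (w₂ x) with h | h
  · exact mul_nonneg_of_nonpos_of_nonpos (sub_nonpos.mpr (monotone_beta hδ h))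
      (sub_nonpos.mpr h)
  · exact mul_nonneg (sub_nonneg.mpr (monotone_beta hδ h)) (sub_nonneg.mpr h)

theorem inner_betaDerivL2_sub_nonneg {δ : ℝ} (hδ : 0 < δ) (w p q : L2 Ω) :
    0 ≤ ⟪betaDerivL2 δ w p - betaDerivL2 δ w q, p - q⟫_ℝ := by
  refine inner_L2_nonneg_of_ae ?_
  filter_upwards [Lp.coeFn_sub (betaDerivL2 δ w p) (betaDerivL2 δ w q), Lp.coeFn_sub p q,
    (memLp_betaDeriv_mul δ w p).coeFn_toLp, (memLp_betaDeriv_mul δ w q).coeFn_toLp]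
    with x h₁ h₂ h₃ h₄
  rw [h₁, h₂, Pi.sub_apply, Pi.sub_apply, betaDerivL2, betaDerivL2, h₃, h₄, ← mul_sub, mul_assoc]
  exact mul_nonneg (betaDeriv_nonneg hδ _) (mul_self_nonneg _)

theorem F1_subsingleton {σ : H1 Ω →L[ℝ] H1 Ω →L[ℝ] ℝ} (hσ : IsCoercive σ) (f : L2 Ω) {δ : ℝ}
    (hδ : 0 < δ) (φ ψ : U Ω) : (F1 σ f δ φ ψ).Subsingleton := by
  intro y hy y' hy'
  refine eq_of_opA_add_toHminus1_eq hσ (hy.trans hy'.symm) ?_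
  have h₁ := inner_betaL2_sub_nonneg hδ (fn y - fn φ) (fn y' - fn φ)
  -- The term `-β_δ(ψ - y)` is also monotone in `y`: both of its signs flip.
  have h₂ := inner_betaL2_sub_nonneg hδ (fn ψ - fn y') (fn ψ - fn y)
  rw [sub_sub_sub_cancel_right] at h₁
  rw [sub_sub_sub_cancel_left] at h₂
  rw [sub_sub_sub_comm, sub_eq_add_neg, neg_sub, inner_add_left]
  exact add_nonneg h₁ h₂

theorem F2_subsingleton {σ : H1 Ω →L[ℝ] H1 Ω →L[ℝ] ℝ} (hσ : IsCoercive σ) (z : L2 Ω) {δ : ℝ}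
    (hδ : 0 < δ) (y φ ψ : U Ω) : (F2 σ z δ y φ ψ).Subsingleton := by
  intro p hp q hq
  have heq := Eq.trans hp (Eq.symm hq)
  rw [add_assoc, add_assoc, ← toHminus1_add, ← toHminus1_add] at heq
  refine eq_of_opA_add_toHminus1_eq hσ heq ?_
  rw [add_sub_add_comm, inner_add_left]
  exact add_nonneg (inner_betaDerivL2_sub_nonneg hδ _ _ _) (inner_betaDerivL2_sub_nonneg hδ _ _ _)

theorem opAstar_eq_opA {σ : H1 Ω →L[ℝ] H1 Ω →L[ℝ] ℝ} (hσ : ∀ u v, σ u v = σ v u) (u : H1 Ω) :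
    opAstar σ u = opA σ u := by
  ext v
  exact hσ _ _

end ObstacleControl

end

theorem mainTheorem3 {d : ℕ} (Ω : Set (EuclideanSpace ℝ (Fin d))) (hΩ : IsOpen Ω)
    (σ : ObstacleControl.H1 Ω →L[ℝ] ObstacleControl.H1 Ω →L[ℝ] ℝ)
    (hσ_coercive : IsCoercive σ) (hσ_symm : ∀ u v, σ u v = σ v u)
    (f z : ObstacleControl.L2 Ω) (ν δ : ℝ) (hν : 0 < ν) (hδ : 0 < δ)
    (φ ψ : ObstacleControl.U Ω)
    (hfix : (φ, ψ) ∈ ObstacleControl.F σ f z ν δ (φ, ψ)) :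
    ∃ y p : ObstacleControl.U Ω,
      ObstacleControl.F1 σ f δ φ ψ = {y} ∧
      ObstacleControl.F2 σ z δ y φ ψ = {p} ∧
      ObstacleControl.OptimalitySystem σ f z ν δ y p φ ψ := by
  obtain ⟨y, hy, p, hp, -, hψ⟩ := hfix
  refine ⟨y, p, (ObstacleControl.F1_subsingleton hσ_coercive f hδ φ ψ).eq_singleton_of_mem hy,
    (ObstacleControl.F2_subsingleton hσ_coercive z hδ y φ ψ).eq_singleton_of_mem hp, hy, ?_, ?_⟩
  · rw [ObstacleControl.opAstar_eq_opA hσ_symm]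
    exact hp
  · have h := add_eq_zero_iff_eq_neg.mpr hψ
    rw [ObstacleControl.multiplier] at h
    rw [← h]
    abel
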